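/- Fix $r \ge 3$ and $\alpha \in (0,1)$. For positive integers $n_1,\dots,n_{r-1}$ put $n=\prod_{j=1}^{r-1} n_j$, $n_{(j)}=\prod_{i\neq j} n_i$, $n_{\min}=\min_j n_j$, $P_j = 1_{n_j}1_{n_j}^{\mathrm T}/n_j$ and $\mathcal P_j = P_1\otimes\cdots\otimes P_{j-1}\otimes I_{n_j}\otimes P_{j+1}\otimes\cdots\otimes P_{r-1}$. The crossed random effects model is $$Y\sim \mathrm N(1_n\beta,\Sigma(\psi)),\qquad \Sigma(\psi)=\sum_{j=1}^{r-1}\psi_j n_{(j)}\mathcal P_j+\psi_r I_n,$$ with $\beta\in\mathbb R$ and $\psi\in\mathbb P=[0,\infty)^{r-1}\times(0,\infty)$; $\mathrm P_\psi$ denotes probability under this model. Let $V\in\mathbb R^{n\times(n-1)}$ satisfy $V^{\mathrm T}V=I_{n-1}$ and $V^{\mathrm T}1_n=0$, let $\tilde Y=V^{\mathrm T}Y\sim \mathrm N(0,\tilde\Sigma(\psi))$ with $\tilde\Sigma(\psi)=V^{\mathrm T}\Sigma(\psi)V$, and define the restricted log-likelihood, restricted score and restricted information by $$\tilde\ell(\psi)=-\tfrac12\{\log|\tilde\Sigma(\psi)|+\tilde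 Y^{\mathrm T}\tilde\Sigma(\psi)^{-1}\tilde Y\},\qquad \tilde S(\psi)=\nabla_\psi\tilde\ell(\psi),\qquad \tilde{\mathcal I}(\psi)=\mathrm{cov}_\psi\{\tilde S(\psi)\}.$$ (At boundary points of $\mathbb P$, $\tilde\ell$ is given by the same formula in a neighbourhood of $\psi$.) Let $\tilde T^S(\psi)=\Vert\tilde{\mathcal I}(\psi)^{-1/2}\tilde S(\psi)\Vert^2$, defined when $\tilde{\mathcal I}(\psi)$ is invertible, and let the restricted score confidence region be $$\tilde{\mathbb C}^S(\alpha)=\{\psi\in\mathbb P:\tilde T^S(\psi)\le c_{r,1-\alpha}\},$$ where $c_{r,1-\alpha}$ is the $(1-\alpha)$th quantile of the chi-squared distribution with $r$ degrees of freedom. Suppose that for each $k\in\{1,2,\dots\}$ such a model is given, with the same $r$, where $n_1,\dots,n_{r-1}$, $\beta$ and $V$ may depend on $k$ in any way such that $n_{\min}=n_{\min}^k\to\infty$ as $k\to\infty$. Then, as $k\to\infty$, $$\sup_{\psi\in[0,\infty)^{r-1}\times(0,\infty)}\left|\mathrm P_\psi\{\psi\in\tilde{\mathbb C}^S(\alpha)\}-(1-\alpha)\right|\to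 0.$$ -/

import Mathlib

open MeasureTheory ProbabilityTheory Filter Topology

noncomputable section

namespace LMM

open scoped Matrix MatrixOrder

section Score

/-! ### Score statistics in a mean-zero Gaussian covariance model -/

variable {ι ρ : Type*} [Fintype ι] [DecidableEq ι] [Fintype ρ] [DecidableEq ρ]

/-- Log-likelihood, up to an additive constant, of `N(0, Σ(ψ))` at the observation `y`:
`-(log |Σ(ψ)| + yᵀ Σ(ψ)⁻¹ y) / 2`. -/
def logLik (Sig : (ρ → ℝ) → Matrix ι ι ℝ) (ψ : ρ → ℝ) (y : EuclideanSpace ℝ ι) : ℝ :=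
  -(1 / 2) * (Real.log (Sig ψ).det + y.ofLp ⬝ᵥ ((Sig ψ)⁻¹ *ᵥ y.ofLp))

/-- The score: the vector of partial derivatives of the log-likelihood in `ψ`. -/
def score (Sig : (ρ → ℝ) → Matrix ι ι ℝ) (ψ : ρ → ℝ) (y : EuclideanSpace ℝ ι) : ρ → ℝ :=
  fun j => deriv (fun t => logLik Sig (Function.update ψ j t) y) (ψ j)

/-- The Fisher information: the covariance matrix of the score at `ψ` under `N(0, Σ(ψ))`. -/
def fisherInfo (Sig : (ρ → ℝ) → Matrix ι ι ℝ) (ψ : ρ → ℝ) : Matrix ρ ρ ℝ :=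
  Matrix.of fun i j =>
    cov[fun y => score Sig ψ y i, fun y => score Sig ψ y j; multivariateGaussian 0 (Sig ψ)]

/-- The standardized score `I(ψ)^(-1/2) S(ψ)`. -/
def stdScore (Sig : (ρ → ℝ) → Matrix ι ι ℝ) (ψ : ρ → ℝ) (y : EuclideanSpace ℝ ι) :
    EuclideanSpace ℝ ρ :=
  WithLp.toLp 2 ((CFC.sqrt (fisherInfo Sig ψ))⁻¹ *ᵥ score Sig ψ y)

/-- The score test-statistic: the squared Euclidean norm of the standardized score. -/
def scoreStat (Sig : (ρ → ℝ) → Matrix ι ι ℝ) (ψ : ρ → ℝ) (y : EuclideanSpace ℝ ι) : ℝ :=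
  ‖stdScore Sig ψ y‖ ^ 2

/-- The restricted score test-statistic: the score statistic of the model
`Vᵀ Y ~ N(0, Vᵀ Σ(ψ) V)`, evaluated at `Vᵀ y`. -/
def restrictedScoreStat {κ : Type*} [Fintype κ] [DecidableEq κ] (V : Matrix ι κ ℝ)
    (Sig : (ρ → ℝ) → Matrix ι ι ℝ) (ψ : ρ → ℝ) (y : EuclideanSpace ℝ ι) : ℝ :=
  scoreStat (fun ψ' => Vᵀ * Sig ψ' * V) ψ (WithLp.toLp 2 (Vᵀ *ᵥ y.ofLp))

end Score

/-- The chi-squared distribution with `r` degrees of freedom: the law of the sum of squares of `r`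
independent standard normal variables. -/
def chiSq (r : ℕ) : Measure ℝ :=
  (Measure.pi fun _ : Fin r => gaussianReal 0 1).map fun x => ∑ i, x i ^ 2

/-- The `p`-th quantile of the chi-squared distribution with `r` degrees of freedom. -/
def chiSqQuantile (r : ℕ) (p : ℝ) : ℝ :=
  sInf {t : ℝ | p ≤ cdf (chiSq r) t}

section Crossed

/-! ### Crossed random effects

There are `s = r - 1` crossed random effects with `n 0, …, n (s - 1)` levels. Observations are
indexed by the cells `(i_0, …, i_{s-1})`, and `ψ : Fin (s + 1) → ℝ` lists the `s` random effect
variances followed by the error variance. -/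

variable {s : ℕ}

/-- The cells, i.e. the indices of the `n = ∏ j, n j` observations. -/
abbrev Cell (n : Fin s → ℕ) : Type := ∀ j, Fin (n j)

/-- The Kronecker product `M 0 ⊗ M 1 ⊗ ⋯ ⊗ M (s - 1)`. -/
def kron {n : Fin s → ℕ} (M : ∀ j, Matrix (Fin (n j)) (Fin (n j)) ℝ) :
    Matrix (Cell n) (Cell n) ℝ :=
  Matrix.of fun a b => ∏ j, M j (a j) (b j)

/-- The averaging matrix `1 1ᵀ / m`. -/
def avg (m : ℕ) : Matrix (Fin m) (Fin m) ℝ := Matrix.of fun _ _ => (1 : ℝ) / m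

/-- The Kronecker product with the identity in position `j` and averaging matrices elsewhere. -/
def crossedProj (n : Fin s → ℕ) (j : Fin s) : Matrix (Cell n) (Cell n) ℝ :=
  kron fun i => if i = j then 1 else avg (n i)

/-- The covariance matrix `Σ(ψ) = ∑ⱼ ψⱼ (∏_{i ≠ j} nᵢ) 𝒫ⱼ + ψᵣ I`. -/
def crossedSigma (n : Fin s → ℕ) (ψ : Fin (s + 1) → ℝ) : Matrix (Cell n) (Cell n) ℝ :=
  ∑ j : Fin s, (ψ j.castSucc * ∏ i ∈ Finset.univ.erase j, (n i : ℝ)) • crossedProj n j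
    + ψ (Fin.last s) • (1 : Matrix (Cell n) (Cell n) ℝ)

/-- The parameter set `[0, ∞)^(r - 1) × (0, ∞)`. -/
def paramSet (s : ℕ) : Set (Fin (s + 1) → ℝ) :=
  {ψ | (∀ j : Fin s, 0 ≤ ψ j.castSucc) ∧ 0 < ψ (Fin.last s)}

/-- The law `N(β 1, Σ(ψ))` of the responses. -/
def crossedLaw (n : Fin s → ℕ) (β : ℝ) (ψ : Fin (s + 1) → ℝ) :
    Measure (EuclideanSpace ℝ (Cell n)) :=
  multivariateGaussian (WithLp.toLp 2 fun _ => β) (crossedSigma n ψ)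

/-- The restricted score confidence region with nominal level `1 - α` computed from `y`. -/
def restrictedScoreRegion (n : Fin s → ℕ) {κ : Type*} [Fintype κ] [DecidableEq κ]
    (V : Matrix (Cell n) κ ℝ) (α : ℝ) (y : EuclideanSpace ℝ (Cell n)) :
    Set (Fin (s + 1) → ℝ) :=
  {ψ ∈ paramSet s |
    restrictedScoreStat V (crossedSigma n) ψ y ≤ chiSqQuantile (s + 1) (1 - α)}

end Crossed

end LMM

end

/-! The score statistic is pivotal, so uniformity in `ψ` costs nothing and only a central limit
theorem remains. Products of distinct `crossedProj n j` equal the overall average, which `V`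
annihilates. In the coordinates of `V` these matrices are therefore mutually orthogonal projections;
together with the residual projection they resolve the identity (`restrictedProj_mul`,
`sum_restrictedProj`). Hence one orthogonal `U` diagonalizes every restricted covariance, with
eigenvalues `ψ ᵥ* varianceMap n`, an invertible linear function of `ψ`. In such a model the score is
`M z`, where `M` is invertible and `z` lists the standardized sums of squares of the whitened data
over the eigenspaces. Since `z` has identity covariance, the information is `M Mᵀ`, and the
statistic is `‖z‖²` (`scoreStat_of_diagonal`). The entries of `z` are independent, with laws fixed
by the eigenspace dimensions (`map_stdSum`), so the coverage is free of `ψ`, `β` and `V`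
(`coverage_eq`). All the dimensions tend to infinity: `n j - 1` for each effect, and a remainder
that is at least `n 0 - 1`. Thus `z` tends to a standard normal vector, and the chi-squared law has
no atom at its quantile. -/

noncomputable section

namespace LMM

open scoped Matrix MatrixOrder

/-! ### Simultaneous diagonalization of a resolution of the identity -/

section Diagonalization

variable {κ ρ : Type*} [Fintype κ] [DecidableEq κ] [Fintype ρ] [DecidableEq ρ]

/-- A resolution of the identity into orthogonal projections is diagonalized by one orthogonal
matrix, each of whose columns lies in the range of exactly one of the projections. -/
lemma exists_orthogonal_diagonalization (Q : ρ → Matrix κ κ ℝ) (hsymm : ∀ k, (Q k)ᵀ = Q k)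
    (hmul : ∀ i j, Q i * Q j = if i = j then Q i else 0) (hsum : ∑ k, Q k = 1) :
    ∃ (U : Matrix κ κ ℝ) (c : κ → ρ), Uᵀ * U = 1 ∧ U * Uᵀ = 1 ∧
      ∀ k, Q k = U * Matrix.diagonal (fun a => if c a = k then 1 else 0) * Uᵀ := by
  -- Distinct weights make `A` act by a different scalar on each range, so an eigenvector of `A`
  -- lies in exactly one of them.
  let f : ρ → ℝ := fun k => (Fintype.equivFin ρ k : ℕ)
  have hf : Function.Injective f := fun i j h => by
    simpa [f, Fin.val_inj] using h
  let A : Matrix κ κ ℝ := ∑ k, f k • Q k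
  have hA : A.IsHermitian := by
    rw [Matrix.IsHermitian, Matrix.conjTranspose_eq_transpose_of_trivial]
    simp [A, Matrix.transpose_sum, hsymm]
  have hQA : ∀ k, Q k * A = f k • Q k := fun k => by
    simp [A, Finset.mul_sum, hmul]
  let u : κ → κ → ℝ := fun a => (hA.eigenvectorBasis a).ofLp
  have hu : ∀ a, A *ᵥ u a = hA.eigenvalues a • u a := hA.mulVec_eigenvectorBasis
  have hu0 : ∀ a, u a ≠ 0 := fun a h => hA.eigenvectorBasis.orthonormal.ne_zero a (by
    ext i; exact congrFun h i)
  have key : ∀ a k, Q k *ᵥ u a ≠ 0 → f k = hA.eigenvalues a := fun a k h => by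
    have h1 : f k • (Q k *ᵥ u a) = hA.eigenvalues a • (Q k *ᵥ u a) := by
      rw [← Matrix.smul_mulVec, ← hQA, ← Matrix.mulVec_mulVec, hu, Matrix.mulVec_smul]
    by_contra hne
    rw [← sub_eq_zero, ← sub_smul, smul_eq_zero] at h1
    exact h1.elim (fun h2 => hne (sub_eq_zero.1 h2)) h
  have hsum' : ∀ a, ∑ k, Q k *ᵥ u a = u a := fun a => by
    rw [← Matrix.sum_mulVec, hsum, Matrix.one_mulVec]
  have hex : ∀ a, ∃ k, Q k *ᵥ u a ≠ 0 := fun a => by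
    by_contra! h
    exact hu0 a (by rw [← hsum' a]; simp [h])
  choose c hc using hex
  have hoff : ∀ a k, k ≠ c a → Q k *ᵥ u a = 0 := fun a k hk => by
    by_contra h
    exact hk (hf ((key a k h).trans (key a _ (hc a)).symm))
  have hon : ∀ a, Q (c a) *ᵥ u a = u a := fun a => by
    conv_rhs => rw [← hsum' a]
    exact (Finset.sum_eq_single _ (fun k _ hk => hoff a k hk) (by simp)).symm
  let U : Matrix κ κ ℝ := hA.eigenvectorUnitary
  have hUT : star U = Uᵀ := by
    rw [Matrix.star_eq_conjTranspose, Matrix.conjTranspose_eq_transpose_of_trivial]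
  have hU1 : Uᵀ * U = 1 := by rw [← hUT]; exact Unitary.coe_star_mul_self hA.eigenvectorUnitary
  have hU2 : U * Uᵀ = 1 := by rw [← hUT]; exact Unitary.coe_mul_star_self hA.eigenvectorUnitary
  have hUa : ∀ i a, U i a = u a i := fun i a => rfl
  refine ⟨U, c, hU1, hU2, fun k => ?_⟩
  have : Q k * U = U * Matrix.diagonal (fun a => if c a = k then 1 else 0) := by
    ext i a
    rw [Matrix.mul_diagonal]
    have h1 : (Q k * U) i a = (Q k *ᵥ u a) i := by
      simp [Matrix.mul_apply, Matrix.mulVec, dotProduct, hUa]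
    rw [h1]
    by_cases hk : c a = k
    · subst hk; simp [hon, hUa]
    · simp [hoff a k (Ne.symm hk), hk]
  rw [← this, Matrix.mul_assoc, hU2, Matrix.mul_one]

end Diagonalization

/-! ### Moments of squared normals and whitening of Gaussian laws -/

section Gaussian

/-- The variance of the square of a standard normal variable. -/
def sqVar : ℝ := Var[fun x => x ^ 2; gaussianReal 0 1]

lemma memLp_sq_gaussianReal : MemLp (fun x : ℝ => x ^ 2) 2 (gaussianReal 0 1) := by
  have h := memLp_id_gaussianReal' (μ := 0) (v := 1) 4 (by simp)
  rw [memLp_two_iff_integrable_sq (by fun_prop)]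
  have h2 := h.integrable_norm_pow (by norm_num)
  refine h2.congr (ae_of_all _ fun x => ?_)
  simp only [id, Real.norm_eq_abs]
  rw [← pow_mul]
  exact (Even.pow_abs (by decide) x)

lemma integral_sq_gaussianReal : ∫ x, x ^ 2 ∂(gaussianReal 0 1) = 1 := by
  have h := variance_fun_id_gaussianReal (μ := 0) (v := 1)
  rw [variance_eq_integral (by fun_prop)] at h
  simpa using h

/-- Zero variance would force `x ^ 2 = 1` almost surely, but the atomless normal law gives `{1, -1}`
measure zero. -/
lemma sqVar_pos : 0 < sqVar := by
  refine (variance_nonneg _ _).lt_of_ne' fun h => ?_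
  have h1 := ae_eq_integral_of_variance_eq_zero memLp_sq_gaussianReal h
  rw [integral_sq_gaussianReal] at h1
  have : NullSingletonClass (gaussianReal 0 1) := nullSingletonClass_gaussianReal one_ne_zero
  have h2 : ∀ᵐ x ∂(gaussianReal 0 1), x ∉ ({1, -1} : Set ℝ) := by
    refine measure_eq_zero_iff_ae_notMem.1 ((Set.toFinite _).measure_zero _)
  obtain ⟨x, hx1, hx2⟩ := (h1.and h2).exists
  exact hx2 (by simpa using hx1)

variable {ι κ : Type*} [Fintype ι] [DecidableEq ι] [Fintype κ] [DecidableEq κ]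

/-- A linear map that standardizes the mean and the covariance matrix standardizes the law. -/
lemma map_multivariateGaussian_of_standardize {m : EuclideanSpace ℝ ι} {S : Matrix ι ι ℝ}
    (hS : S.PosSemidef) (B : Matrix κ ι ℝ) (hBm : B *ᵥ m.ofLp = 0) (hBS : B * S * Bᵀ = 1) :
    (multivariateGaussian m S).map (fun y => B *ᵥ y.ofLp)
      = Measure.pi fun _ : κ => gaussianReal 0 1 := by
  have hmeas : Measurable fun y : EuclideanSpace ℝ ι => B *ᵥ y.ofLp := by
    refine Continuous.measurable ?_
    fun_prop
  have := Measure.isProbabilityMeasure_map (μ := multivariateGaussian m S) hmeas.aemeasurable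
  rw [← charFun_eq_pi_iff]
  intro t
  rw [Measure.map_map (by fun_prop) hmeas, charFun_apply, integral_map (by fun_prop) (by fun_prop)]
  have h := charFun_multivariateGaussian (μ := m) hS (WithLp.toLp 2 (Bᵀ *ᵥ t.ofLp))
  rw [charFun_apply] at h
  have hin : ∀ y : EuclideanSpace ℝ ι,
      inner ℝ (((WithLp.toLp 2) ∘ fun y : EuclideanSpace ℝ ι => B *ᵥ y.ofLp) y) t
      = inner ℝ y (WithLp.toLp 2 (Bᵀ *ᵥ t.ofLp)) := fun y => by
    simp only [EuclideanSpace.inner_eq_star_dotProduct, Function.comp, star_trivial]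
    rw [Matrix.dotProduct_mulVec, Matrix.mulVec_transpose]
  simp_rw [hin]
  rw [h]
  have h1 : inner ℝ (WithLp.toLp 2 (Bᵀ *ᵥ t.ofLp)) m = 0 := by
    simp only [EuclideanSpace.inner_eq_star_dotProduct, star_trivial]
    rw [Matrix.dotProduct_mulVec, Matrix.vecMul_transpose, hBm, zero_dotProduct]
  have h2 : (Bᵀ *ᵥ t.ofLp) ⬝ᵥ S *ᵥ (Bᵀ *ᵥ t.ofLp) = t.ofLp ⬝ᵥ t.ofLp := by
    rw [Matrix.mulVec_transpose, ← Matrix.dotProduct_mulVec, ← Matrix.mulVec_transpose,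
      Matrix.mulVec_mulVec, Matrix.mulVec_mulVec, hBS, Matrix.one_mulVec]
  rw [h1, h2]
  simp_rw [charFun_gaussianReal, ← Complex.exp_sum]
  congr 1
  simp [dotProduct, Finset.sum_div, sq]

end Gaussian

/-! ### The score statistic in a simultaneously diagonal model -/

section DiagonalModel

variable {κ ρ : Type*} [Fintype κ] [DecidableEq κ] [Fintype ρ] [DecidableEq ρ]

/-- The centred and scaled sums of the squares of the entries of `x` over the classes of `c`. -/
def stdSum (c : κ → ρ) (x : κ → ℝ) : ρ → ℝ := fun k =>
  (√(sqVar * Fintype.card {a // c a = k}))⁻¹ * ∑ a with c a = k, (x a ^ 2 - 1)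

lemma measurable_stdSum (c : κ → ρ) : Measurable (stdSum c) := by
  unfold stdSum
  fun_prop

lemma inv_conj_diagonal {U : Matrix κ κ ℝ} (hU : Uᵀ * U = 1) {w : κ → ℝ} (hw : ∀ a, w a ≠ 0) :
    (U * Matrix.diagonal w * Uᵀ)⁻¹ = U * Matrix.diagonal (fun a => (w a)⁻¹) * Uᵀ := by
  refine Matrix.inv_eq_right_inv ?_
  calc _ = U * (Matrix.diagonal w * (Uᵀ * U) * Matrix.diagonal fun a => (w a)⁻¹) * Uᵀ := by
        simp only [Matrix.mul_assoc]
    _ = 1 := by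
        simp [hU, Matrix.diagonal_mul_diagonal, hw, mul_eq_one_comm.1 hU]

lemma det_conj_diagonal {U : Matrix κ κ ℝ} (hU : Uᵀ * U = 1) (w : κ → ℝ) :
    (U * Matrix.diagonal w * Uᵀ).det = ∏ a, w a := by
  have h : Uᵀ.det * U.det = 1 := by rw [← Matrix.det_mul, hU, Matrix.det_one]
  rw [Matrix.det_mul, Matrix.det_mul, Matrix.det_diagonal]
  linear_combination (∏ a, w a) * h

lemma posSemidef_conj_diagonal (U : Matrix κ κ ℝ) {w : κ → ℝ} (hw : ∀ a, 0 ≤ w a) :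
    (U * Matrix.diagonal w * Uᵀ).PosSemidef := by
  have := (Matrix.PosSemidef.diagonal (d := w) hw).mul_mul_conjTranspose_same U
  rwa [Matrix.conjTranspose_eq_transpose_of_trivial] at this

variable {U : Matrix κ κ ℝ} {c : κ → ρ} {G : Matrix ρ ρ ℝ} {Sig : (ρ → ℝ) → Matrix κ κ ℝ}

lemma logLik_of_diagonal (hU : Uᵀ * U = 1)
    (hSig : ∀ ψ, Sig ψ = U * Matrix.diagonal (fun a => (ψ ᵥ* G) (c a)) * Uᵀ)
    {ψ : ρ → ℝ} (hψ : ∀ k, (ψ ᵥ* G) k ≠ 0) (y : EuclideanSpace ℝ κ) :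
    logLik Sig ψ y = -(1 / 2) * ∑ a, (Real.log ((ψ ᵥ* G) (c a))
      + (Uᵀ *ᵥ y.ofLp) a ^ 2 / (ψ ᵥ* G) (c a)) := by
  rw [logLik, hSig, det_conj_diagonal hU, inv_conj_diagonal hU fun a => hψ (c a),
    Real.log_prod fun a _ => hψ (c a), Finset.sum_add_distrib]
  congr 2
  rw [← Matrix.mulVec_mulVec, ← Matrix.mulVec_mulVec, Matrix.dotProduct_mulVec,
    ← Matrix.mulVec_transpose]
  simp only [dotProduct, Matrix.mulVec_diagonal]
  exact Finset.sum_congr rfl fun a _ => by ring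

lemma update_vecMul (ψ : ρ → ℝ) (j : ρ) (t : ℝ) (k : ρ) :
    (Function.update ψ j t ᵥ* G) k = (ψ ᵥ* G) k + (t - ψ j) * G j k := by
  have : Function.update ψ j t = ψ + Pi.single j (t - ψ j) := by
    ext i
    by_cases h : i = j
    · subst h; simp
    · simp [h]
  rw [this, Matrix.add_vecMul, Pi.add_apply, Matrix.single_vecMul]
  simp

/-- In the coordinates of `U` the log-likelihood is a sum of one-dimensional Gaussian terms, each
differentiated through an eigenvalue that is linear in `ψ`. -/
lemma score_of_diagonal (hU : Uᵀ * U = 1)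
    (hSig : ∀ ψ, Sig ψ = U * Matrix.diagonal (fun a => (ψ ᵥ* G) (c a)) * Uᵀ)
    {ψ : ρ → ℝ} (hψ : ∀ k, 0 < (ψ ᵥ* G) k) (y : EuclideanSpace ℝ κ) (j : ρ) :
    score Sig ψ y j = ∑ a, G j (c a) / (2 * (ψ ᵥ* G) (c a))
      * ((Uᵀ *ᵥ y.ofLp) a ^ 2 / (ψ ᵥ* G) (c a) - 1) := by
  have hlin : ∀ k, HasDerivAt (fun t => (Function.update ψ j t ᵥ* G) k) (G j k) (ψ j) := fun k => by
    simp only [update_vecMul]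
    simpa using (((hasDerivAt_id (ψ j)).sub_const (ψ j)).mul_const (G j k)).const_add ((ψ ᵥ* G) k)
  have hat : ∀ k, (Function.update ψ j (ψ j) ᵥ* G) k = (ψ ᵥ* G) k := by simp
  have hev : (fun t => logLik Sig (Function.update ψ j t) y) =ᶠ[𝓝 (ψ j)]
      fun t => -(1 / 2) * ∑ a, (Real.log ((Function.update ψ j t ᵥ* G) (c a))
        + (Uᵀ *ᵥ y.ofLp) a ^ 2 / (Function.update ψ j t ᵥ* G) (c a)) := by
    -- Only the eigenvalues at `ψ` need be positive, so the two-sided derivative makes sense even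
    -- where `ψ j = 0`.
    have : ∀ᶠ t in 𝓝 (ψ j), ∀ k, (Function.update ψ j t ᵥ* G) k ≠ 0 := by
      refine eventually_all.2 fun k => (hlin k).continuousAt.eventually_ne ?_
      rw [hat]; exact (hψ k).ne'
    filter_upwards [this] with t ht
    exact logLik_of_diagonal hU hSig ht y
  rw [score, hev.deriv_eq]
  have hd : ∀ a, HasDerivAt (fun t => Real.log ((Function.update ψ j t ᵥ* G) (c a))
        + (Uᵀ *ᵥ y.ofLp) a ^ 2 / (Function.update ψ j t ᵥ* G) (c a))
      (G j (c a) / (ψ ᵥ* G) (c a)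
        - (Uᵀ *ᵥ y.ofLp) a ^ 2 * G j (c a) / (ψ ᵥ* G) (c a) ^ 2) (ψ j) := fun a => by
    have hne := (hψ (c a)).ne'
    have h1 := (hlin (c a)).log (by rwa [hat])
    have h2 := (hasDerivAt_const (ψ j) ((Uᵀ *ᵥ y.ofLp) a ^ 2)).div (hlin (c a)) (by rwa [hat])
    rw [hat] at h1 h2
    exact (h1.add h2).congr_deriv (by ring)
  rw [((HasDerivAt.fun_sum fun a _ => hd a).const_mul (-(1 / 2))).deriv, Finset.mul_sum]
  refine Finset.sum_congr rfl fun a _ => ?_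
  have hne := (hψ (c a)).ne'
  field_simp
  ring

/-- The matrix `diag(w)^(-1/2) Uᵀ`, which standardizes `N(0, U diag(w) Uᵀ)`. -/
def whiten (U : Matrix κ κ ℝ) (w : κ → ℝ) : Matrix κ κ ℝ :=
  Matrix.diagonal (fun a => (√(w a))⁻¹) * Uᵀ

lemma whiten_mul_mul (hU : Uᵀ * U = 1) {w : κ → ℝ} (hw : ∀ a, 0 < w a) :
    whiten U w * (U * Matrix.diagonal w * Uᵀ) * (whiten U w)ᵀ = 1 := by
  rw [whiten, Matrix.transpose_mul, Matrix.transpose_transpose, Matrix.diagonal_transpose]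
  calc _ = Matrix.diagonal (fun a => (√(w a))⁻¹) * ((Uᵀ * U) * Matrix.diagonal w * (Uᵀ * U))
        * Matrix.diagonal (fun a => (√(w a))⁻¹) := by simp only [Matrix.mul_assoc]
    _ = 1 := by
      rw [hU, Matrix.one_mul, Matrix.mul_one, Matrix.diagonal_mul_diagonal,
        Matrix.diagonal_mul_diagonal, ← Matrix.diagonal_one]
      congr 1
      ext a
      have h := Real.mul_self_sqrt (hw a).le
      have h0 := (Real.sqrt_pos.2 (hw a)).ne'
      field_simp
      nlinarith

lemma whiten_mulVec_sq {w : κ → ℝ} (hw : ∀ a, 0 < w a) (y : κ → ℝ) (a : κ) :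
    (whiten U w *ᵥ y) a ^ 2 = (Uᵀ *ᵥ y) a ^ 2 / w a := by
  rw [whiten, ← Matrix.mulVec_mulVec, Matrix.mulVec_diagonal, mul_pow, inv_pow,
    Real.sq_sqrt (hw a).le]
  ring

/-- The matrix that maps `stdSum` to the score. -/
def scoreFactor (c : κ → ρ) (G : Matrix ρ ρ ℝ) (ψ : ρ → ℝ) : Matrix ρ ρ ℝ :=
  Matrix.of fun j k => G j k / (2 * (ψ ᵥ* G) k) * √(sqVar * Fintype.card {a // c a = k})

/-- The coefficients of the score depend on `a` only through its class, so the data enter through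
class sums alone. Surjectivity of `c` keeps the normalizing constants nonzero. -/
lemma score_eq_mulVec_stdSum (hU : Uᵀ * U = 1)
    (hSig : ∀ ψ, Sig ψ = U * Matrix.diagonal (fun a => (ψ ᵥ* G) (c a)) * Uᵀ)
    (hc : Function.Surjective c) {ψ : ρ → ℝ} (hψ : ∀ k, 0 < (ψ ᵥ* G) k)
    (y : EuclideanSpace ℝ κ) :
    score Sig ψ y = scoreFactor c G ψ *ᵥ
      stdSum c (whiten U (fun a => (ψ ᵥ* G) (c a)) *ᵥ y.ofLp) := by
  ext j
  rw [score_of_diagonal hU hSig hψ, ← Finset.sum_fiberwise (s := Finset.univ) (g := c)]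
  simp only [Matrix.mulVec, dotProduct]
  refine Finset.sum_congr rfl fun k _ => ?_
  have hd : √(sqVar * Fintype.card {a // c a = k}) ≠ 0 := by
    obtain ⟨a, ha⟩ := hc k
    have : 0 < Fintype.card {a // c a = k} := Fintype.card_pos_iff.2 ⟨⟨a, ha⟩⟩
    have := sqVar_pos
    positivity
  simp only [scoreFactor, Matrix.of_apply, stdSum]
  rw [mul_assoc, mul_inv_cancel_left₀ hd, Finset.mul_sum]
  refine Finset.sum_congr rfl fun a ha => ?_
  have := whiten_mulVec_sq (U := U) (fun a => hψ (c a)) y.ofLp a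
  simp only [Matrix.mulVec, dotProduct] at this ⊢
  rw [this, (Finset.mem_filter.1 ha).2]

lemma memLp_sq_sub_one_pi (a : κ) :
    MemLp (fun x : κ → ℝ => x a ^ 2 - 1) 2 (Measure.pi fun _ : κ => gaussianReal 0 1) :=
  (memLp_sq_gaussianReal.sub (memLp_const 1)).comp_measurePreserving
    (measurePreserving_eval (fun _ : κ => gaussianReal 0 1) a)

lemma memLp_stdSum (c : κ → ρ) (k : ρ) :
    MemLp (fun x => stdSum c x k) 2 (Measure.pi fun _ : κ => gaussianReal 0 1) := by
  have h : MemLp (fun x : κ → ℝ => ∑ a with c a = k, (x a ^ 2 - 1)) 2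
      (Measure.pi fun _ : κ => gaussianReal 0 1) :=
    memLp_finsetSum _ fun a _ => memLp_sq_sub_one_pi a
  exact h.const_mul _

lemma covariance_sq_pi (a b : κ) :
    cov[fun x => x a ^ 2 - 1, fun x => x b ^ 2 - 1; Measure.pi fun _ : κ => gaussianReal 0 1]
      = if a = b then sqVar else 0 := by
  have hind : iIndepFun (fun (i : κ) (x : κ → ℝ) => x i ^ 2 - 1)
      (Measure.pi fun _ : κ => gaussianReal 0 1) :=
    iIndepFun_pi (X := fun _ x => x ^ 2 - 1) fun i => by fun_prop
  split_ifs with h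
  · subst h
    have h := variance_map (X := fun x : ℝ => x ^ 2 - 1) (Y := fun x : κ → ℝ => x a)
      (μ := Measure.pi fun _ : κ => gaussianReal 0 1)
      (by fun_prop) (measurable_pi_apply a).aemeasurable
    rw [covariance_self (memLp_sq_sub_one_pi a).aemeasurable]
    refine h.symm.trans ?_
    rw [(measurePreserving_eval (fun _ : κ => gaussianReal 0 1) a).map_eq,
      variance_sub_const (by fun_prop), sqVar]
  · exact (hind.indepFun h).covariance_eq_zero (memLp_sq_sub_one_pi a) (memLp_sq_sub_one_pi b)

lemma covariance_stdSum {c : κ → ρ} (hc : Function.Surjective c) (k l : ρ) :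
    cov[fun x => stdSum c x k, fun x => stdSum c x l; Measure.pi fun _ : κ => gaussianReal 0 1]
      = if k = l then 1 else 0 := by
  simp only [stdSum]
  rw [covariance_const_mul_left, covariance_const_mul_right,
    covariance_fun_sum_fun_sum' (fun a _ => memLp_sq_sub_one_pi a) (fun a _ => memLp_sq_sub_one_pi a)]
  simp only [covariance_sq_pi]
  split_ifs with h
  · subst h
    have : ∀ a ∈ Finset.univ.filter (fun a => c a = k),
        (∑ b with c b = k, if a = b then sqVar else 0) = sqVar := fun a ha => by
      rw [Finset.sum_ite_eq, if_pos ha]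
    rw [Finset.sum_congr rfl this, Finset.sum_const, ← Fintype.card_subtype, nsmul_eq_mul]
    have hd : 0 < sqVar * Fintype.card {a // c a = k} := by
      obtain ⟨a, ha⟩ := hc k
      have : 0 < Fintype.card {a // c a = k} := Fintype.card_pos_iff.2 ⟨⟨a, ha⟩⟩
      have := sqVar_pos
      positivity
    rw [mul_comm (Fintype.card _ : ℝ), ← mul_assoc, ← mul_inv, Real.mul_self_sqrt hd.le,
      inv_mul_cancel₀ hd.ne']
  · rw [Finset.sum_eq_zero, mul_zero, mul_zero]
    refine fun a ha => Finset.sum_eq_zero fun b hb => if_neg ?_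
    rintro rfl
    exact h ((Finset.mem_filter.1 ha).2.symm.trans (Finset.mem_filter.1 hb).2)

/-- Whitening transports the covariance to the standard normal law, where `stdSum` has identity
covariance. -/
lemma fisherInfo_of_diagonal (hU : Uᵀ * U = 1)
    (hSig : ∀ ψ, Sig ψ = U * Matrix.diagonal (fun a => (ψ ᵥ* G) (c a)) * Uᵀ)
    (hc : Function.Surjective c) {ψ : ρ → ℝ} (hψ : ∀ k, 0 < (ψ ᵥ* G) k) :
    fisherInfo Sig ψ = scoreFactor c G ψ * (scoreFactor c G ψ)ᵀ := by
  ext i j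
  have hmap := map_multivariateGaussian_of_standardize (m := 0)
    (posSemidef_conj_diagonal U fun a => (hψ (c a)).le)
    (whiten U fun a => (ψ ᵥ* G) (c a)) (by simp) (whiten_mul_mul hU fun a => hψ (c a))
  rw [← hSig] at hmap
  have hm : ∀ i, Measurable fun x : κ → ℝ => (scoreFactor c G ψ *ᵥ stdSum c x) i := fun i => by
    have := measurable_stdSum c
    simp only [Matrix.mulVec, dotProduct]
    fun_prop
  simp only [fisherInfo, Matrix.of_apply, score_eq_mulVec_stdSum hU hSig hc hψ]
  rw [← covariance_map_fun (μ := multivariateGaussian 0 (Sig ψ))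
    (Z := fun y => whiten U (fun a => (ψ ᵥ* G) (c a)) *ᵥ y.ofLp)
    (X := fun x => (scoreFactor c G ψ *ᵥ stdSum c x) i)
    (Y := fun x => (scoreFactor c G ψ *ᵥ stdSum c x) j)
    (hm i).aestronglyMeasurable (hm j).aestronglyMeasurable
    (by refine (Continuous.measurable ?_).aemeasurable; fun_prop), hmap]
  simp only [Matrix.mulVec, dotProduct]
  rw [covariance_fun_sum_fun_sum (fun k => (memLp_stdSum c k).const_mul _)
    (fun k => (memLp_stdSum c k).const_mul _)]
  simp [covariance_const_mul_left, covariance_const_mul_right, covariance_stdSum hc,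
    Matrix.mul_apply, mul_comm]

/-- Standardization by `(M Mᵀ)^(1/2)` undoes an invertible `M` up to an isometry. -/
lemma norm_inv_sqrt_mulVec_sq {M : Matrix ρ ρ ℝ} (hM : IsUnit M.det) (z : ρ → ℝ) :
    ‖(WithLp.toLp 2 ((CFC.sqrt (M * Mᵀ))⁻¹ *ᵥ (M *ᵥ z)) : EuclideanSpace ℝ ρ)‖ ^ 2
      = ∑ k, z k ^ 2 := by
  have hpsd : (M * Mᵀ).PosSemidef := by
    have := Matrix.posSemidef_self_mul_conjTranspose M
    rwa [Matrix.conjTranspose_eq_transpose_of_trivial] at this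
  set R := CFC.sqrt (M * Mᵀ) with hR
  have hRR : R * R = M * Mᵀ := CFC.sqrt_mul_sqrt_self _ hpsd.nonneg
  have hRT : Rᵀ = R := by
    have h : IsSelfAdjoint R := (CFC.sqrt_nonneg (M * Mᵀ)).isSelfAdjoint
    rw [IsSelfAdjoint, Matrix.star_eq_conjTranspose,
      Matrix.conjTranspose_eq_transpose_of_trivial] at h
    exact h
  have hMT : IsUnit Mᵀ.det := by rwa [Matrix.det_transpose]
  -- `R⁻¹ * M` is orthogonal because `R⁻¹ * R⁻¹` is the inverse of `M * Mᵀ`.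
  have key : (R⁻¹ * M)ᵀ * (R⁻¹ * M) = 1 := by
    rw [Matrix.transpose_mul, Matrix.transpose_nonsing_inv, hRT, Matrix.mul_assoc,
      ← Matrix.mul_assoc R⁻¹, ← Matrix.mul_inv_rev, hRR, Matrix.mul_inv_rev, Matrix.mul_assoc,
      Matrix.nonsing_inv_mul _ hM, Matrix.mul_one, Matrix.mul_nonsing_inv _ hMT]
  rw [EuclideanSpace.real_norm_sq_eq, Matrix.mulVec_mulVec]
  have h : ((R⁻¹ * M) *ᵥ z) ⬝ᵥ ((R⁻¹ * M) *ᵥ z) = z ⬝ᵥ z := by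
    rw [Matrix.dotProduct_mulVec, ← Matrix.mulVec_transpose, Matrix.mulVec_mulVec, key,
      Matrix.one_mulVec]
  simpa [dotProduct, sq] using h

lemma isUnit_det_scoreFactor (hG : IsUnit G.det) (hc : Function.Surjective c)
    {ψ : ρ → ℝ} (hψ : ∀ k, 0 < (ψ ᵥ* G) k) : IsUnit (scoreFactor c G ψ).det := by
  have h : scoreFactor c G ψ = G * Matrix.diagonal fun k =>
      (2 * (ψ ᵥ* G) k)⁻¹ * √(sqVar * Fintype.card {a // c a = k}) := by
    ext j k
    simp only [scoreFactor, Matrix.of_apply, Matrix.mul_diagonal]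
    ring
  rw [h, Matrix.det_mul, Matrix.det_diagonal]
  refine hG.mul (isUnit_iff_ne_zero.2 (Finset.prod_ne_zero_iff.2 fun k _ => ?_))
  obtain ⟨a, ha⟩ := hc k
  have : 0 < Fintype.card {a // c a = k} := Fintype.card_pos_iff.2 ⟨⟨a, ha⟩⟩
  have := sqVar_pos
  have := hψ k
  positivity

/-- In a model whose covariance matrices are simultaneously diagonal, with eigenvalues an invertible
linear function of the parameter, the score statistic is a sum of squares of standardized sums of
squares of standardized observations. -/
lemma scoreStat_of_diagonal (hU : Uᵀ * U = 1)
    (hSig : ∀ ψ, Sig ψ = U * Matrix.diagonal (fun a => (ψ ᵥ* G) (c a)) * Uᵀ)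
    (hG : IsUnit G.det) (hc : Function.Surjective c) {ψ : ρ → ℝ} (hψ : ∀ k, 0 < (ψ ᵥ* G) k)
    (y : EuclideanSpace ℝ κ) :
    scoreStat Sig ψ y
      = ∑ k, stdSum c (whiten U (fun a => (ψ ᵥ* G) (c a)) *ᵥ y.ofLp) k ^ 2 := by
  rw [scoreStat, stdScore, fisherInfo_of_diagonal hU hSig hc hψ,
    score_eq_mulVec_stdSum hU hSig hc hψ,
    norm_inv_sqrt_mulVec_sq (isUnit_det_scoreFactor hG hc hψ)]

end DiagonalModel

/-! ### Central limit theorem and the chi-squared quantile -/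

section Limit

/-- The law of the standardized square of a standard normal variable. -/
def stdSqLaw : Measure ℝ := (gaussianReal 0 1).map fun x => (x ^ 2 - 1) / √sqVar

/-- The law of the standardized sum of squares of `d` independent standard normal variables. -/
def stdSqSumLaw (d : ℕ) : Measure ℝ :=
  (Measure.pi fun _ : Fin d => gaussianReal 0 1).map
    fun x => (√d)⁻¹ * ∑ i, (x i ^ 2 - 1) / √sqVar

instance (d : ℕ) : IsProbabilityMeasure (stdSqSumLaw d) :=
  Measure.isProbabilityMeasure_map (Measurable.aemeasurable (by fun_prop))

/-- `stdSqSumLaw` as a bundled probability measure. -/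
def stdSqSumProb (d : ℕ) : ProbabilityMeasure ℝ := ⟨stdSqSumLaw d, inferInstance⟩

/-- The standard normal law as a bundled probability measure. -/
def stdNormalProb : ProbabilityMeasure ℝ := ⟨gaussianReal 0 1, inferInstance⟩

variable {κ ρ : Type*} [Fintype κ] [DecidableEq κ] [Fintype ρ] [DecidableEq ρ]

/-- With constant weights this gives the characteristic function of `stdSqSumLaw`; with weights
constant on classes, the joint one of `stdSum`. -/
lemma integral_exp_sum_stdSq (w : κ → ℝ) :
    ∫ x, Complex.exp ((∑ a, w a * ((x a ^ 2 - 1) / √sqVar) : ℝ) * Complex.I)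
      ∂(Measure.pi fun _ : κ => gaussianReal 0 1) = ∏ a, charFun stdSqLaw (w a) := by
  have h : ∀ a, charFun stdSqLaw (w a)
      = ∫ x, Complex.exp ((w a * ((x ^ 2 - 1) / √sqVar) : ℝ) * Complex.I) ∂(gaussianReal 0 1) := by
    intro a
    rw [stdSqLaw, charFun_apply_real, integral_map (by fun_prop) (by fun_prop)]
    simp
  simp_rw [h]
  rw [← integral_fintype_prod_eq_prod (μ := fun _ : κ => gaussianReal 0 1)
    fun a x => Complex.exp ((w a * ((x ^ 2 - 1) / √sqVar) : ℝ) * Complex.I)]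
  congr 1
  ext x
  rw [← Complex.exp_sum, ← Finset.sum_mul, Complex.ofReal_sum]

lemma charFun_stdSqSumLaw (d : ℕ) (t : ℝ) :
    charFun (stdSqSumLaw d) t = charFun stdSqLaw ((√d)⁻¹ * t) ^ d := by
  rw [stdSqSumLaw, charFun_apply_real,
    integral_map (Measurable.aemeasurable (by fun_prop)) (by fun_prop)]
  have h := integral_exp_sum_stdSq fun _ : Fin d => (√d)⁻¹ * t
  rw [Finset.prod_const, Finset.card_univ, Fintype.card_fin] at h
  rw [← h]
  congr 1
  ext x
  rw [← Complex.ofReal_mul, ← mul_assoc, mul_comm t, Finset.mul_sum]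

lemma stdSum_eq (c : κ → ρ) (x : κ → ℝ) (k : ρ) :
    stdSum c x k = ∑ a with c a = k,
      (√(Fintype.card {a // c a = k}))⁻¹ * ((x a ^ 2 - 1) / √sqVar) := by
  rw [stdSum, Real.sqrt_mul sqVar_pos.le, Finset.mul_sum]
  exact Finset.sum_congr rfl fun i _ => by rw [mul_inv]; ring

/-- Standardized sums of squares over disjoint classes are independent, with laws that depend only
on the sizes of the classes. -/
lemma map_stdSum (c : κ → ρ) :
    (Measure.pi fun _ : κ => gaussianReal 0 1).map (stdSum c)
      = Measure.pi fun k => stdSqSumLaw (Fintype.card {a // c a = k}) := by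
  have hm := measurable_stdSum c
  have := Measure.isProbabilityMeasure_map (μ := Measure.pi fun _ : κ => gaussianReal 0 1)
    hm.aemeasurable
  rw [← charFun_eq_pi_iff]
  intro t
  rw [Measure.map_map (by fun_prop) hm, charFun_apply, integral_map (by fun_prop) (by fun_prop)]
  have h := integral_exp_sum_stdSq fun a : κ => (√(Fintype.card {b // c b = c a}))⁻¹ * t (c a)
  have hin : ∀ x : κ → ℝ, inner ℝ ((WithLp.toLp 2 ∘ stdSum c) x) t
      = ∑ a, (√(Fintype.card {b // c b = c a}))⁻¹ * t (c a) * ((x a ^ 2 - 1) / √sqVar) := by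
    intro x
    rw [← Finset.sum_fiberwise (s := Finset.univ) (g := c), PiLp.inner_apply]
    refine Finset.sum_congr rfl fun k _ => ?_
    simp only [Function.comp, stdSum_eq]
    rw [real_inner_comm, Real.inner_apply, Finset.mul_sum]
    refine Finset.sum_congr rfl fun a ha => ?_
    rw [(Finset.mem_filter.1 ha).2]
    ring
  simp_rw [hin]
  rw [h, ← Finset.prod_fiberwise (s := Finset.univ) (g := c)]
  refine Finset.prod_congr rfl fun k _ => ?_
  rw [charFun_stdSqSumLaw, Fintype.card_subtype, ← Finset.prod_const]
  refine Finset.prod_congr rfl fun a ha => ?_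
  rw [(Finset.mem_filter.1 ha).2, Fintype.card_subtype]

lemma tendsto_stdSqSumLaw :
    Tendsto stdSqSumProb atTop (𝓝 stdNormalProb) := by
  refine ProbabilityMeasure.tendsto_iff_tendsto_charFun.2 fun t => ?_
  have hLp : MemLp (fun x : ℝ => x ^ 2 - 1) 2 (gaussianReal 0 1) :=
    memLp_sq_gaussianReal.sub (memLp_const 1)
  have hmean : ∫ x : ℝ, (x ^ 2 - 1) ∂(gaussianReal 0 1) = 0 := by
    rw [integral_sub (memLp_sq_gaussianReal.integrable one_le_two) (integrable_const 1),
      integral_sq_gaussianReal]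
    simp
  have h := tendsto_charFun_inv_sqrt_mul_pow (P := gaussianReal 0 1)
    (X := fun x => (x ^ 2 - 1) / √sqVar) (by fun_prop) (by rw [integral_div, hmean, zero_div]) ?_ t
  · simpa [stdSqSumProb, stdNormalProb, charFun_stdSqSumLaw, charFun_gaussianReal, stdSqLaw, neg_div] using h
  · simp only [Pi.pow_apply, div_pow]
    rw [integral_div, Real.sq_sqrt sqVar_pos.le, div_eq_one_iff_eq sqVar_pos.ne', sqVar,
      variance_eq_integral (by fun_prop), integral_sq_gaussianReal]

/-- By Fubini: once the other coordinates are fixed, the first can take at most two values. This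
gives both the null frontier for weak convergence and the continuity of the chi-squared distribution
function. -/
lemma measure_sum_sq_eq_zero (m : ℕ) (q : ℝ) :
    (Measure.pi fun _ : Fin (m + 1) => gaussianReal 0 1) {z | ∑ i, z i ^ 2 = q} = 0 := by
  have hmp := measurePreserving_piFinSuccAbove (fun _ : Fin (m + 1) => gaussianReal 0 1) 0
  have hms : MeasurableSet {p : ℝ × (Fin m → ℝ) | p.1 ^ 2 + ∑ i, p.2 i ^ 2 = q} :=
    measurableSet_eq_fun (by fun_prop) (by fun_prop)
  have hpre : {z : Fin (m + 1) → ℝ | ∑ i, z i ^ 2 = q}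
      = MeasurableEquiv.piFinSuccAbove (fun _ => ℝ) 0 ⁻¹'
        {p : ℝ × (Fin m → ℝ) | p.1 ^ 2 + ∑ i, p.2 i ^ 2 = q} := by
    ext z
    simp [MeasurableEquiv.piFinSuccAbove, Fin.insertNthEquiv, Fin.sum_univ_succ, Fin.tail]
  rw [hpre, hmp.measure_preimage hms.nullMeasurableSet, Measure.prod_apply_symm hms, lintegral_eq_zero_iff
    (measurable_measure_prodMk_right hms)]
  have : NullSingletonClass (gaussianReal 0 1) := nullSingletonClass_gaussianReal one_ne_zero
  refine ae_of_all _ fun y => Set.Finite.measure_zero ?_ _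
  refine (Set.toFinite {√(q - ∑ i, y i ^ 2), -√(q - ∑ i, y i ^ 2)}).subset fun x hx => ?_
  have hx' : x ^ 2 = q - ∑ i, y i ^ 2 := eq_sub_of_add_eq hx
  rw [← hx', Real.sqrt_sq_eq_abs]
  rcases abs_cases x with h | h <;> simp [h.1]

lemma tendsto_pi_stdSqSumLaw {m : ℕ} {d : ℕ → Fin (m + 1) → ℕ}
    (hd : ∀ k, Tendsto (fun n => d n k) atTop atTop) (q : ℝ) :
    Tendsto (fun n => (Measure.pi fun k => stdSqSumLaw (d n k)).real {z | ∑ k, z k ^ 2 ≤ q})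
      atTop (𝓝 ((Measure.pi fun _ : Fin (m + 1) => gaussianReal 0 1).real
        {z | ∑ k, z k ^ 2 ≤ q})) := by
  have h1 : Tendsto (fun n k => stdSqSumProb (d n k)) atTop
      (𝓝 fun _ : Fin (m + 1) => stdNormalProb) :=
    tendsto_pi_nhds.2 fun k => tendsto_stdSqSumLaw.comp (hd k)
  have h2 := (ProbabilityMeasure.continuous_pi.tendsto _).comp h1
  have h3 := ProbabilityMeasure.tendsto_measure_of_null_frontier_of_tendsto'
    (E := {z : Fin (m + 1) → ℝ | ∑ k, z k ^ 2 ≤ q}) h2 ?_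
  · exact (ENNReal.tendsto_toReal (measure_ne_top _ _)).comp h3
  · refine measure_mono_null (frontier_le_subset_eq (by fun_prop) (by fun_prop)) ?_
    exact measure_sum_sq_eq_zero m q

instance (r : ℕ) : IsProbabilityMeasure (chiSq r) :=
  Measure.isProbabilityMeasure_map (Measurable.aemeasurable (by fun_prop))

lemma continuous_cdf_chiSq (m : ℕ) : Continuous (cdf (chiSq (m + 1))) := by
  refine continuous_iff_continuousAt.2 fun x => ?_
  refine (cdf (chiSq (m + 1))).mono.continuousAt_iff_leftLim_eq_rightLim.2 ?_
  rw [(cdf (chiSq (m + 1))).rightLim_eq]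
  have h : (cdf (chiSq (m + 1))).measure {x} = 0 := by
    rw [measure_cdf, chiSq, Measure.map_apply (by fun_prop) (measurableSet_singleton x)]
    exact measure_sum_sq_eq_zero m x
  rw [StieltjesFunction.measure_singleton, ENNReal.ofReal_eq_zero, sub_nonpos] at h
  exact le_antisymm ((cdf (chiSq (m + 1))).mono.leftLim_le le_rfl) h

/-- The chi-squared distribution function takes the value `p` at the `p`-th quantile. -/
lemma measure_sum_sq_le_chiSqQuantile (m : ℕ) {p : ℝ} (hp : p ∈ Set.Ioo (0 : ℝ) 1) :
    (Measure.pi fun _ : Fin (m + 1) => gaussianReal 0 1).real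
      {z | ∑ k, z k ^ 2 ≤ chiSqQuantile (m + 1) p} = p := by
  have hcont := continuous_cdf_chiSq m
  have h1 : cdf (chiSq (m + 1)) (chiSqQuantile (m + 1) p) = p := by
    obtain ⟨a, ha⟩ := ((tendsto_cdf_atBot (chiSq (m + 1))).eventually (eventually_lt_nhds hp.1)).exists
    obtain ⟨b, hb⟩ := ((tendsto_cdf_atTop (chiSq (m + 1))).eventually (eventually_gt_nhds hp.2)).exists
    obtain ⟨t, ht⟩ := mem_range_of_exists_le_of_exists_ge hcont ⟨a, ha.le⟩ ⟨b, hb.le⟩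
    -- The real `sInf` is a true infimum only for a nonempty set bounded below; `a` provides the
    -- bound and `t` the element.
    have hbdd : BddBelow {t : ℝ | p ≤ cdf (chiSq (m + 1)) t} :=
      ⟨a, fun u hu => le_of_not_gt fun hua =>
        absurd (hu.trans (monotone_cdf (chiSq (m + 1)) hua.le)) (not_le.2 ha)⟩
    refine le_antisymm ?_ ?_
    · rw [← ht]
      exact monotone_cdf _ (csInf_le (ht ▸ hbdd) (le_refl (cdf (chiSq (m + 1)) t)))
    · exact (isClosed_le continuous_const hcont).csInf_mem ⟨t, ht.ge⟩ hbdd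
  rw [cdf_eq_real, chiSq, map_measureReal_apply (by fun_prop) measurableSet_Iic] at h1
  exact h1

end Limit

/-! ### The projection orthogonal to the ones vector -/

section Complement

variable {ι κ : Type*} [Fintype ι] [DecidableEq ι] [Fintype κ] [DecidableEq κ]

/-- The projection on the orthogonal complement of the vector of ones. -/
lemma mul_transpose_eq_one_sub {V : Matrix ι κ ℝ} (hV : Vᵀ * V = 1)
    (hV1 : Vᵀ *ᵥ (fun _ => (1 : ℝ)) = 0) (hcard : Fintype.card ι = Fintype.card κ + 1) :
    V * Vᵀ = 1 - Matrix.of fun _ _ => (1 : ℝ) / Fintype.card ι := by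
  have hpos : (0 : ℝ) < Fintype.card ι := by rw [hcard]; positivity
  -- The normalized ones vector completes `V` to a square matrix with orthonormal columns; its left
  -- inverse is then also a right inverse.
  let e : Matrix ι Unit ℝ := Matrix.of fun _ _ => (√(Fintype.card ι : ℝ))⁻¹
  have hsum : ∀ b, ∑ i, V i b = 0 := fun b => by
    simpa [Matrix.mulVec, dotProduct] using congrFun hV1 b
  have h12 : Vᵀ * e = 0 := by
    ext b u
    simp [e, Matrix.mul_apply, ← Finset.sum_mul, hsum]
  have h21 : eᵀ * V = 0 := by
    rw [← Matrix.transpose_transpose V, ← Matrix.transpose_mul, h12, Matrix.transpose_zero]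
  have h22 : eᵀ * e = 1 := by
    ext u v
    simp only [e, Matrix.mul_apply, Matrix.transpose_apply, Matrix.of_apply, Finset.sum_const,
      Finset.card_univ, nsmul_eq_mul, ← mul_inv, Real.mul_self_sqrt hpos.le]
    rw [mul_inv_cancel₀ hpos.ne', Matrix.one_apply_eq]
  have h : (Matrix.fromCols V e)ᵀ * Matrix.fromCols V e = 1 := by
    rw [Matrix.transpose_fromCols, Matrix.fromRows_mul_fromCols, hV, h12, h21, h22,
      Matrix.fromBlocks_one]
  have h := (Matrix.mul_eq_one_comm_of_card_eq _ _ _ (by simp [hcard])).1 h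
  rw [Matrix.transpose_fromCols, Matrix.fromCols_mul_fromRows] at h
  rw [eq_sub_iff_add_eq, ← h]
  congr 1
  ext i j
  simp [e, Matrix.mul_apply, ← mul_inv]

end Complement

/-! ### Weighted sums and traces of spectral projections -/

section Spectral

variable {κ ρ : Type*} [Fintype κ] [DecidableEq κ] [Fintype ρ] [DecidableEq ρ]

lemma sum_smul_conj_indicator (U : Matrix κ κ ℝ) (c : κ → ρ) (w : ρ → ℝ) :
    ∑ k, w k • (U * Matrix.diagonal (fun a => if c a = k then (1 : ℝ) else 0) * Uᵀ)
      = U * Matrix.diagonal (fun a => w (c a)) * Uᵀ := by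
  have h : Matrix.diagonal (fun a => w (c a))
      = ∑ k, w k • Matrix.diagonal (fun a => if c a = k then (1 : ℝ) else 0) := by
    ext a b
    by_cases hab : a = b
    · subst hab; simp [Matrix.sum_apply]
    · simp [Matrix.sum_apply, hab]
  rw [h, Finset.mul_sum, Finset.sum_mul]
  simp

/-- Class sizes, which are known only through the chosen `c`, are recovered from traces of the
projections. -/
lemma trace_conj_indicator {U : Matrix κ κ ℝ} (hU : Uᵀ * U = 1) (c : κ → ρ) (k : ρ) :
    (U * Matrix.diagonal (fun a => if c a = k then (1 : ℝ) else 0) * Uᵀ).trace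
      = Fintype.card {a // c a = k} := by
  rw [Matrix.trace_mul_comm, ← Matrix.mul_assoc, hU, Matrix.one_mul, Matrix.trace_diagonal,
    Fintype.card_subtype]
  simp

end Spectral

/-! ### Algebra of the crossed projections -/

section Kronecker

variable {s : ℕ} {n : Fin s → ℕ}

lemma kron_mul (A B : ∀ j, Matrix (Fin (n j)) (Fin (n j)) ℝ) :
    kron A * kron B = kron fun j => A j * B j := by
  ext a b
  simp only [kron, Matrix.mul_apply, Matrix.of_apply, ← Finset.prod_mul_distrib]
  exact (Fintype.prod_sum fun j x => A j (a j) x * B j x (b j)).symm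

lemma kron_transpose (A : ∀ j, Matrix (Fin (n j)) (Fin (n j)) ℝ) :
    (kron A)ᵀ = kron fun j => (A j)ᵀ := rfl

lemma trace_kron (A : ∀ j, Matrix (Fin (n j)) (Fin (n j)) ℝ) :
    (kron A).trace = ∏ j, (A j).trace := by
  simp only [kron, Matrix.trace, Matrix.diag, Matrix.of_apply]
  exact (Fintype.prod_sum fun j x => A j x x).symm

lemma avg_mul_avg {m : ℕ} (hm : m ≠ 0) : avg m * avg m = avg m := by
  have : (m : ℝ) ≠ 0 := Nat.cast_ne_zero.2 hm
  ext a b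
  simp [avg, Matrix.mul_apply, this]

lemma trace_avg {m : ℕ} (hm : m ≠ 0) : (avg m).trace = 1 := by
  have : (m : ℝ) ≠ 0 := Nat.cast_ne_zero.2 hm
  simp [avg, Matrix.trace, this]

lemma avg_transpose (m : ℕ) : (avg m)ᵀ = avg m := rfl

lemma kron_avg_eq : kron (fun j => avg (n j))
    = Matrix.of fun _ _ => (1 : ℝ) / Fintype.card (Cell n) := by
  ext a b
  simp [kron, avg, Fintype.card_pi]

/-- A tensor slot of the product stays the identity only if both factors have the identity there. -/
lemma crossedProj_mul (hn : ∀ j, n j ≠ 0) (i j : Fin s) :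
    crossedProj n i * crossedProj n j
      = if i = j then crossedProj n i else kron fun j => avg (n j) := by
  rw [crossedProj, crossedProj, kron_mul]
  split_ifs with h
  · subst h
    congr 1
    ext1 l
    split_ifs <;> simp [avg_mul_avg (hn l)]
  · congr 1
    ext1 l
    by_cases h1 : l = i
    · subst h1; simp [h]
    · by_cases h2 : l = j
      · subst h2; simp [h1]
      · simp [h1, h2, avg_mul_avg (hn l)]

lemma crossedProj_mul_kron_avg (hn : ∀ j, n j ≠ 0) (i : Fin s) :
    crossedProj n i * kron (fun j => avg (n j)) = kron fun j => avg (n j) := by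
  rw [crossedProj, kron_mul]
  congr 1
  ext1 l
  split_ifs <;> simp [avg_mul_avg (hn l)]

lemma crossedProj_transpose (j : Fin s) : (crossedProj n j)ᵀ = crossedProj n j := by
  rw [crossedProj, kron_transpose]
  congr 1
  ext1 l
  split_ifs <;> simp [avg_transpose]

lemma trace_crossedProj (hn : ∀ j, n j ≠ 0) (j : Fin s) : (crossedProj n j).trace = n j := by
  rw [crossedProj, trace_kron, Finset.prod_eq_single j]
  · simp
  · intro i _ hi
    simp [hi, trace_avg (hn i)]
  · simp

lemma posSemidef_crossedSigma (hn : ∀ j, n j ≠ 0) {ψ : Fin (s + 1) → ℝ} (hψ : ψ ∈ paramSet s) :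
    (crossedSigma n ψ).PosSemidef := by
  refine Matrix.PosSemidef.add ?_ (Matrix.PosSemidef.one.smul hψ.2.le)
  refine Matrix.posSemidef_sum _ fun j _ => Matrix.PosSemidef.smul ?_ ?_
  · have h := Matrix.posSemidef_self_mul_conjTranspose (crossedProj n j)
    rwa [Matrix.conjTranspose_eq_transpose_of_trivial, crossedProj_transpose, crossedProj_mul hn,
      if_pos rfl] at h
  · exact mul_nonneg (hψ.1 j) (Finset.prod_nonneg fun i _ => by positivity)

end Kronecker

/-! ### Spectrum of the restricted model and its exact coverage -/

section Restricted

variable {s : ℕ} {n : Fin s → ℕ} {κ : Type*} [Fintype κ] [DecidableEq κ]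

/-- The projections on the contrasts of the random effects and on the residual space, in the
coordinates given by `V`. -/
def restrictedProj (n : Fin s → ℕ) (V : Matrix (Cell n) κ ℝ) (k : Fin (s + 1)) : Matrix κ κ ℝ :=
  Fin.lastCases (motive := fun _ => Matrix κ κ ℝ) (1 - ∑ j, Vᵀ * crossedProj n j * V)
    (fun j => Vᵀ * crossedProj n j * V) k

@[simp]
lemma restrictedProj_last (V : Matrix (Cell n) κ ℝ) :
    restrictedProj n V (Fin.last s) = 1 - ∑ j, Vᵀ * crossedProj n j * V := by
  simp [restrictedProj]

@[simp]
lemma restrictedProj_castSucc (V : Matrix (Cell n) κ ℝ) (j : Fin s) :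
    restrictedProj n V j.castSucc = Vᵀ * crossedProj n j * V := by
  simp [restrictedProj]

lemma restrictedProj_transpose (V : Matrix (Cell n) κ ℝ) (k : Fin (s + 1)) :
    (restrictedProj n V k)ᵀ = restrictedProj n V k := by
  have h : ∀ j, (Vᵀ * crossedProj n j * V)ᵀ = Vᵀ * crossedProj n j * V := fun j => by
    rw [Matrix.transpose_mul, Matrix.transpose_mul, Matrix.transpose_transpose,
      crossedProj_transpose, Matrix.mul_assoc]
  refine Fin.lastCases ?_ (fun j => ?_) k
  · simp [Matrix.transpose_sub, Matrix.transpose_sum, h]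
  · simp [h]

lemma sum_restrictedProj (V : Matrix (Cell n) κ ℝ) : ∑ k, restrictedProj n V k = 1 := by
  simp [Fin.sum_univ_castSucc]

variable {V : Matrix (Cell n) κ ℝ}

lemma mul_transpose_eq_one_sub_kron_avg (hV : Vᵀ * V = 1) (hV1 : Vᵀ *ᵥ (fun _ => (1 : ℝ)) = 0)
    (hcard : Fintype.card (Cell n) = Fintype.card κ + 1) :
    V * Vᵀ = 1 - kron fun j => avg (n j) := by
  rw [mul_transpose_eq_one_sub hV hV1 hcard, kron_avg_eq]

lemma kron_avg_mul (hV1 : Vᵀ *ᵥ (fun _ => (1 : ℝ)) = 0) :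
    kron (fun j => avg (n j)) * V = 0 := by
  have hsum : ∀ b, ∑ i, V i b = 0 := fun b => by
    simpa [Matrix.mulVec, dotProduct] using congrFun hV1 b
  rw [kron_avg_eq]
  ext a b
  simp [Matrix.mul_apply, ← Finset.mul_sum, hsum]

/-- Substituting `V * Vᵀ = 1 - kron avg` in the middle leaves the product of the two crossed
projections plus a multiple of the overall average, and `V` kills every overall average. -/
lemma restricted_crossedProj_mul (hn : ∀ j, n j ≠ 0) (hV : Vᵀ * V = 1)
    (hV1 : Vᵀ *ᵥ (fun _ => (1 : ℝ)) = 0) (hcard : Fintype.card (Cell n) = Fintype.card κ + 1)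
    (i j : Fin s) :
    (Vᵀ * crossedProj n i * V) * (Vᵀ * crossedProj n j * V)
      = if i = j then Vᵀ * crossedProj n i * V else 0 := by
  have h : (Vᵀ * crossedProj n i * V) * (Vᵀ * crossedProj n j * V)
      = Vᵀ * ((crossedProj n i * (V * Vᵀ)) * crossedProj n j) * V := by
    simp only [Matrix.mul_assoc]
  have h0 : kron (fun j => avg (n j)) * crossedProj n j = kron fun j => avg (n j) := by
    have := congrArg Matrix.transpose (crossedProj_mul_kron_avg hn j)
    rwa [Matrix.transpose_mul, crossedProj_transpose, kron_transpose] at this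
  rw [h, mul_transpose_eq_one_sub_kron_avg hV hV1 hcard, Matrix.mul_sub, Matrix.mul_one,
    crossedProj_mul_kron_avg hn, Matrix.sub_mul, crossedProj_mul hn, h0, Matrix.mul_sub,
    Matrix.sub_mul, Matrix.mul_assoc _ (kron _), kron_avg_mul hV1, Matrix.mul_zero, sub_zero]
  split_ifs
  · rfl
  · rw [Matrix.mul_assoc, kron_avg_mul hV1, Matrix.mul_zero]

lemma restrictedProj_mul (hn : ∀ j, n j ≠ 0) (hV : Vᵀ * V = 1)
    (hV1 : Vᵀ *ᵥ (fun _ => (1 : ℝ)) = 0) (hcard : Fintype.card (Cell n) = Fintype.card κ + 1)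
    (k l : Fin (s + 1)) :
    restrictedProj n V k * restrictedProj n V l = if k = l then restrictedProj n V k else 0 := by
  have h := restricted_crossedProj_mul hn hV hV1 hcard
  refine Fin.lastCases ?_ (fun i => ?_) k <;> refine Fin.lastCases ?_ (fun j => ?_) l
  · simp [Matrix.mul_sub, Matrix.sub_mul, Finset.mul_sum, Finset.sum_mul, h]
  · simp [Matrix.sub_mul, Finset.sum_mul, h, (Fin.castSucc_ne_last _).symm]
  · simp [Matrix.mul_sub, Finset.mul_sum, h, Fin.castSucc_ne_last]
  · simp [h]

/-- The ranks of the projections `restrictedProj`. -/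
def degreesOfFreedom (n : Fin s → ℕ) (k : Fin (s + 1)) : ℕ :=
  Fin.lastCases (motive := fun _ => ℕ) (((∏ j, n j) - 1) - ∑ j, (n j - 1)) (fun j => n j - 1) k

@[simp]
lemma degreesOfFreedom_last (n : Fin s → ℕ) :
    degreesOfFreedom n (Fin.last s) = ((∏ j, n j) - 1) - ∑ j, (n j - 1) := by
  simp [degreesOfFreedom]

@[simp]
lemma degreesOfFreedom_castSucc (n : Fin s → ℕ) (j : Fin s) :
    degreesOfFreedom n j.castSucc = n j - 1 := by
  simp [degreesOfFreedom]

lemma trace_restricted_crossedProj (hn : ∀ j, n j ≠ 0) (hV : Vᵀ * V = 1)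
    (hV1 : Vᵀ *ᵥ (fun _ => (1 : ℝ)) = 0) (hcard : Fintype.card (Cell n) = Fintype.card κ + 1)
    (j : Fin s) : (Vᵀ * crossedProj n j * V).trace = ((n j - 1 : ℕ) : ℝ) := by
  rw [Matrix.mul_assoc, Matrix.trace_mul_comm, Matrix.mul_assoc,
    mul_transpose_eq_one_sub_kron_avg hV hV1 hcard, Matrix.mul_sub, Matrix.mul_one,
    crossedProj_mul_kron_avg hn, Matrix.trace_sub, trace_crossedProj hn, trace_kron,
    Finset.prod_eq_one fun i _ => trace_avg (hn i),
    Nat.cast_sub (Nat.one_le_iff_ne_zero.2 (hn j)), Nat.cast_one]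

lemma add_sum_le_prod {ι : Type*} (t : Finset ι) (m : ι → ℕ) (hm : ∀ i, 1 ≤ m i) :
    1 + ∑ i ∈ t, (m i - 1) ≤ ∏ i ∈ t, m i := by
  classical
  induction t using Finset.induction with
  | empty => simp
  | insert a t ha ih =>
    rw [Finset.sum_insert ha, Finset.prod_insert ha]
    obtain ⟨p, hp⟩ := Nat.exists_eq_add_of_le (hm a)
    rw [hp]
    have := Nat.mul_le_mul_left p ((Nat.le_add_right 1 _).trans ih)
    have h1 : (1 + p) * ∏ i ∈ t, m i = ∏ i ∈ t, m i + p * ∏ i ∈ t, m i := by ring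
    omega

/-- With `N` the product of the other level counts, the residual dimension is at least `(n 0 - 1) *
(N - 1)`, by `add_sum_le_prod`. A second factor gives `N ≥ 2`; with `s = 1` the residual space would
be trivial. -/
lemma le_degreesOfFreedom_last (hs : 2 ≤ s) (hn : ∀ j, 2 ≤ n j) :
    n ⟨0, by omega⟩ - 1 ≤ degreesOfFreedom n (Fin.last s) := by
  rw [degreesOfFreedom_last]
  set i₀ : Fin s := ⟨0, by omega⟩
  set i₁ : Fin s := ⟨1, by omega⟩
  have hne : i₁ ∈ Finset.univ.erase i₀ := by simp [i₀, i₁]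
  have h := add_sum_le_prod (Finset.univ.erase i₀) n fun i => one_le_two.trans (hn i)
  have h1 : n i₁ - 1 ≤ ∑ i ∈ Finset.univ.erase i₀, (n i - 1) :=
    Finset.single_le_sum (f := fun i => n i - 1) (fun i _ => Nat.zero_le _) hne
  have h2 := hn i₁
  rw [← Finset.mul_prod_erase _ _ (Finset.mem_univ i₀),
    ← Finset.add_sum_erase _ _ (Finset.mem_univ i₀)]
  obtain ⟨p, hp⟩ := Nat.exists_eq_add_of_le (one_le_two.trans (hn i₀))
  rw [hp]
  have h3 : 2 ≤ ∏ i ∈ Finset.univ.erase i₀, n i := by omega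
  have h4 := Nat.mul_le_mul_left p h3
  have h5 : (1 + p) * ∏ i ∈ Finset.univ.erase i₀, n i
    = ∏ i ∈ Finset.univ.erase i₀, n i + p * ∏ i ∈ Finset.univ.erase i₀, n i := by ring
  omega

lemma degreesOfFreedom_pos (hs : 2 ≤ s) (hn : ∀ j, 2 ≤ n j) (k : Fin (s + 1)) :
    0 < degreesOfFreedom n k := by
  refine Fin.lastCases ?_ (fun j => ?_) k
  · have := le_degreesOfFreedom_last hs hn
    have := hn ⟨0, by omega⟩
    omega
  · have := hn j
    rw [degreesOfFreedom_castSucc]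
    omega

/-- The matrix that maps the variance parameters to the eigenvalues of the restricted covariance
matrix. -/
def varianceMap (n : Fin s → ℕ) : Matrix (Fin (s + 1)) (Fin (s + 1)) ℝ :=
  Matrix.of fun j k => Fin.lastCases (motive := fun _ => ℝ) 1
    (fun j' => if j'.castSucc = k then ∏ i ∈ Finset.univ.erase j', (n i : ℝ) else 0) j

lemma vecMul_varianceMap_last (ψ : Fin (s + 1) → ℝ) :
    (ψ ᵥ* varianceMap n) (Fin.last s) = ψ (Fin.last s) := by
  simp [Matrix.vecMul, dotProduct, varianceMap, Fin.sum_univ_castSucc, Fin.castSucc_ne_last]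

lemma vecMul_varianceMap_castSucc (ψ : Fin (s + 1) → ℝ) (j : Fin s) :
    (ψ ᵥ* varianceMap n) j.castSucc
      = ψ j.castSucc * ∏ i ∈ Finset.univ.erase j, (n i : ℝ) + ψ (Fin.last s) := by
  simp [Matrix.vecMul, dotProduct, varianceMap, Fin.sum_univ_castSucc]

/-- The matrix is lower triangular: each effect feeds only its own eigenvalue, while the error
variance, in the last row, feeds all of them. -/
lemma isUnit_det_varianceMap (hn : ∀ j, n j ≠ 0) : IsUnit (varianceMap n).det := by
  have h : (varianceMap n).BlockTriangular OrderDual.toDual := fun j k hjk => by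
    have hjk' : j < k := hjk
    obtain ⟨j, rfl⟩ : ∃ j' : Fin s, j = j'.castSucc :=
      ⟨_, (Fin.castSucc_castPred j (hjk'.trans_le (Fin.le_last k)).ne).symm⟩
    simp [varianceMap, hjk'.ne]
  rw [Matrix.det_of_isLowerTriangular _ h, isUnit_iff_ne_zero, Finset.prod_ne_zero_iff]
  intro k _
  refine Fin.lastCases ?_ (fun j => ?_) k
  · simp [varianceMap]
  · simp [varianceMap, Finset.prod_ne_zero_iff, hn]

lemma vecMul_varianceMap_pos {ψ : Fin (s + 1) → ℝ} (hψ : ψ ∈ paramSet s) (k : Fin (s + 1)) :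
    0 < (ψ ᵥ* varianceMap n) k := by
  refine Fin.lastCases ?_ (fun j => ?_) k
  · rw [vecMul_varianceMap_last]; exact hψ.2
  · rw [vecMul_varianceMap_castSucc]
    exact add_pos_of_nonneg_of_pos
      (mul_nonneg (hψ.1 j) (Finset.prod_nonneg fun i _ => by positivity)) hψ.2

/-- The error term becomes a multiple of the identity, which is spread over all the projections. -/
lemma restricted_crossedSigma (hV : Vᵀ * V = 1) (ψ : Fin (s + 1) → ℝ) :
    Vᵀ * crossedSigma n ψ * V = ∑ k, (ψ ᵥ* varianceMap n) k • restrictedProj n V k := by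
  rw [Fin.sum_univ_castSucc]
  simp only [vecMul_varianceMap_last, vecMul_varianceMap_castSucc, restrictedProj_last,
    restrictedProj_castSucc, crossedSigma, Matrix.mul_add, Matrix.add_mul, Matrix.mul_sum,
    Matrix.sum_mul, Matrix.mul_smul, Matrix.smul_mul, Matrix.mul_one, hV, add_smul, smul_sub,
    Finset.sum_add_distrib, Finset.smul_sum]
  abel

/-- The exact coverage probability of the restricted score region, which depends neither on the
parameters nor on the choice of `V`. -/
lemma coverage_eq (hs : 2 ≤ s) (hn : ∀ j, 2 ≤ n j) (hV : Vᵀ * V = 1)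
    (hV1 : Vᵀ *ᵥ (fun _ => (1 : ℝ)) = 0) (hcard : Fintype.card (Cell n) = Fintype.card κ + 1)
    (α β : ℝ) {ψ : Fin (s + 1) → ℝ} (hψ : ψ ∈ paramSet s) :
    (crossedLaw n β ψ).real {y | ψ ∈ restrictedScoreRegion n V α y}
      = (Measure.pi fun k => stdSqSumLaw (degreesOfFreedom n k)).real
          {z | ∑ k, z k ^ 2 ≤ chiSqQuantile (s + 1) (1 - α)} := by
  have hn0 : ∀ j, n j ≠ 0 := fun j => by have := hn j; omega
  obtain ⟨U, c, hU, -, hQ⟩ := exists_orthogonal_diagonalization (restrictedProj n V)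
    (restrictedProj_transpose V) (restrictedProj_mul hn0 hV hV1 hcard) (sum_restrictedProj V)
  have hSig : ∀ ψ, Vᵀ * crossedSigma n ψ * V
      = U * Matrix.diagonal (fun a => (ψ ᵥ* varianceMap n) (c a)) * Uᵀ := fun ψ => by
    rw [restricted_crossedSigma hV, ← sum_smul_conj_indicator]
    exact Finset.sum_congr rfl fun k _ => by rw [← hQ]
  have htr : ∀ k, ((Fintype.card {a // c a = k} : ℕ) : ℝ) = (restrictedProj n V k).trace :=
    fun k => by rw [hQ, trace_conj_indicator hU]
  have hdof : ∀ k, Fintype.card {a // c a = k} = degreesOfFreedom n k := by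
    have hc : ∀ j : Fin s, Fintype.card {a // c a = j.castSucc} = n j - 1 := fun j => by
      have h := htr j.castSucc
      rw [restrictedProj_castSucc, trace_restricted_crossedProj hn0 hV hV1 hcard] at h
      exact_mod_cast h
    refine fun k => Fin.lastCases ?_ (fun j => ?_) k
    · have h := htr (Fin.last s)
      rw [restrictedProj_last, Matrix.trace_sub, Matrix.trace_one, Matrix.trace_sum,
        Finset.sum_congr rfl fun j _ => trace_restricted_crossedProj hn0 hV hV1 hcard j,
        eq_sub_iff_add_eq] at h
      have h' : Fintype.card {a // c a = Fin.last s} + ∑ j, (n j - 1) = Fintype.card κ := by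
        exact_mod_cast h
      have hcell : Fintype.card (Cell n) = ∏ j, n j := by simp [Fintype.card_pi]
      rw [degreesOfFreedom_last]
      omega
    · rw [hc, degreesOfFreedom_castSucc]
  -- Positive dimension means that no eigenspace is empty.
  have hsurj : Function.Surjective c := fun k => by
    have h := degreesOfFreedom_pos hs hn k
    rw [← hdof, Fintype.card_pos_iff] at h
    exact ⟨h.some.1, h.some.2⟩
  have hpos := vecMul_varianceMap_pos (n := n) hψ
  let w : κ → ℝ := fun a => (ψ ᵥ* varianceMap n) (c a)
  -- `Vᵀ` removes the mean, so `β` disappears here; whitening then removes `ψ`.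
  have hlaw : (crossedLaw n β ψ).map (fun y => (whiten U w * Vᵀ) *ᵥ y.ofLp)
      = Measure.pi fun _ : κ => gaussianReal 0 1 := by
    refine map_multivariateGaussian_of_standardize (posSemidef_crossedSigma hn0 hψ) _ ?_ ?_
    · have : (fun _ : Cell n => β) = β • fun _ => (1 : ℝ) := by ext; simp
      rw [← Matrix.mulVec_mulVec, this, Matrix.mulVec_smul, hV1, smul_zero, Matrix.mulVec_zero]
    · have h := whiten_mul_mul hU (w := w) fun a => hpos (c a)
      rw [← hSig] at h
      rw [← h, Matrix.transpose_mul, Matrix.transpose_transpose]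
      simp only [Matrix.mul_assoc]
  have hset : {y | ψ ∈ restrictedScoreRegion n V α y}
      = (fun y : EuclideanSpace ℝ (Cell n) => (whiten U w * Vᵀ) *ᵥ y.ofLp) ⁻¹'
        (stdSum c ⁻¹' {z | ∑ k, z k ^ 2 ≤ chiSqQuantile (s + 1) (1 - α)}) := by
    ext y
    simp only [restrictedScoreRegion, Set.mem_ofPred_eq, Set.mem_preimage, hψ, true_and,
      restrictedScoreStat]
    rw [scoreStat_of_diagonal hU hSig (isUnit_det_varianceMap hn0) hsurj hpos,
      ← Matrix.mulVec_mulVec]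
  have hm1 : Measurable fun y : EuclideanSpace ℝ (Cell n) => (whiten U w * Vᵀ) *ᵥ y.ofLp := by
    refine Continuous.measurable ?_
    fun_prop
  have hm2 : MeasurableSet {z : Fin (s + 1) → ℝ |
      ∑ k, z k ^ 2 ≤ chiSqQuantile (s + 1) (1 - α)} :=
    measurableSet_le (by fun_prop) (by fun_prop)
  have hm3 := measurable_stdSum c
  rw [hset, ← map_measureReal_apply hm1 (hm3 hm2), hlaw, ← map_measureReal_apply hm3 hm2,
    map_stdSum]
  simp only [hdof]

end Restricted

end LMM

end

/-! ### Uniform asymptotic coverage -/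

open scoped Matrix in
/-- Uniform asymptotic coverage of the restricted score confidence region with `s = r - 1 ≥ 2`
crossed random effects. The columns of `V k` are an orthonormal basis of the orthogonal complement
of the vector of ones. -/
theorem corollary5 (s : ℕ) (hs : 2 ≤ s) (n : ℕ → Fin s → ℕ)
    (hn : Tendsto (fun k => ⨅ j, n k j) atTop atTop)
    (β : ℕ → ℝ)
    (V : ∀ k, Matrix (LMM.Cell (n k)) (Fin ((∏ j, n k j) - 1)) ℝ)
    (hV : ∀ k, (V k)ᵀ * V k = 1)
    (hVX : ∀ k, (V k)ᵀ *ᵥ (fun _ => (1 : ℝ)) = 0)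
    (α : ℝ) (hα : α ∈ Set.Ioo (0 : ℝ) 1) :
    Tendsto (fun k => ⨆ ψ : LMM.paramSet s,
        |(LMM.crossedLaw (n k) (β k) ψ).real
            {y | (ψ : Fin (s + 1) → ℝ) ∈ LMM.restrictedScoreRegion (n k) (V k) α y} - (1 - α)|)
      atTop (𝓝 0) := by
  have hnj : ∀ j, Tendsto (fun k => n k j) atTop atTop := fun j =>
    tendsto_atTop_mono (fun k => ciInf_le (OrderBot.bddBelow _) j) hn
  have h2 : ∀ᶠ k in atTop, ∀ j, 2 ≤ n k j :=
    eventually_all.2 fun j => (hnj j).eventually_ge_atTop 2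
  have hdof : ∀ i, Tendsto (fun k => LMM.degreesOfFreedom (n k) i) atTop atTop := fun i => by
    refine Fin.lastCases ?_ (fun j => ?_) i
    · refine tendsto_atTop_mono' _ (h2.mono fun k hk => LMM.le_degreesOfFreedom_last hs hk) ?_
      exact (tendsto_sub_atTop_nat 1).comp (hnj _)
    · simp only [LMM.degreesOfFreedom_castSucc]
      exact (tendsto_sub_atTop_nat 1).comp (hnj j)
  have hlim := LMM.tendsto_pi_stdSqSumLaw hdof (LMM.chiSqQuantile (s + 1) (1 - α))
  rw [LMM.measure_sum_sq_le_chiSqQuantile s ⟨by linarith [hα.2], by linarith [hα.1]⟩] at hlim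
  have hzero := (hlim.sub_const (1 - α)).abs
  rw [sub_self, abs_zero] at hzero
  -- The exact coverage formula needs at least two levels per factor, which holds only eventually.
  refine hzero.congr' (h2.mono fun k hk => ?_)
  have hcard : Fintype.card (LMM.Cell (n k)) = Fintype.card (Fin ((∏ j, n k j) - 1)) + 1 := by
    have : 0 < ∏ j, n k j := Finset.prod_pos fun j _ => by have := hk j; omega
    simp only [Fintype.card_pi, Fintype.card_fin]
    omega
  -- The supremum of a constant family equals that constant once the index set is nonempty.
  have : Nonempty (LMM.paramSet s) := ⟨⟨fun _ => 1, fun _ => zero_le_one, one_pos⟩⟩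
  have hcov := fun ψ : LMM.paramSet s =>
    LMM.coverage_eq hs hk (hV k) (hVX k) hcard α (β k) ψ.2
  simp only [hcov, ciSup_const]
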